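/- A metric signature $S$ consists of function symbols and predicate symbols, each with a finite arity and a modulus of uniform continuity $\mathbb{Q}\cap(0,1)\to\mathbb{Q}\cap(0,1)$, and of constant symbols; it is countable if it has countably many symbols. An $S$-structure is a metric space $M$ of diameter at most $1$ together with an interpretation of each function symbol as a function $M^k\to M$, of each predicate symbol as a function $M^k\to[0,1]$ (where $k$ is the arity), each obeying the modulus $\delta$ of its symbol (for all $\varepsilon\in\mathbb{Q}\cap(0,1)$, if the arguments are coordinatewise at distance $<\delta(\varepsilon)$, then the values are at distance $\le\varepsilon$), and of each constant symbol as an element of $M$. The formulas of $\mathcal{L}_{\omega_1,\omega}$ over $S$ are generated from the atomic formulas $d(t_1,t_2)$ and $R(t_1,\dots,t_k)$ (with $t_i$ terms and $R$ a $k$-ary predicate symbol) by continuous connectives $f:[0,1]^k\to[0,1]$, $k<\omega$, by the quantifiers $\sup_x$ and $\inf_x$, and by countable suprema $\sup_{m<\omega}\phi_m$ and infima $\inf_{m<\omega}\phi_m$ of formulas whose free variables all lie in one finite set (no continuity is required of the result). The value $\phi^M(\vec a)\in[0,1]$ is defined by the obvious recursion. An automorphism of $M$ is an isometric bijection $\Phi:M\to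 M$ that preserves the interpretations of all symbols. Theorem. Let $M$ be a separable complete metric structure in a countable signature, let $n\ge 0$, and let $P:M^n\to[0,1]$ be continuous. The following are equivalent: (1) there is an $\mathcal{L}_{\omega_1,\omega}$ formula $\phi(x_1,\dots,x_n)$ such that $\phi^M(\vec a)=P(\vec a)$ for all $\vec a\in M^n$; (2) $P(\Phi(a_1),\dots,\Phi(a_n))=P(a_1,\dots,a_n)$ for every automorphism $\Phi$ of $M$ and all $(a_1,\dots,a_n)\in M^n$. -/

import Mathlib

universe u v w x

/-- A modulus of uniform continuity: a function `ℚ ∩ (0,1) → ℚ ∩ (0,1)`. -/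
abbrev UCModulus : Type := Set.Ioo (0 : ℚ) 1 → Set.Ioo (0 : ℚ) 1

/-- A metric signature: function symbols and predicate symbols, each with an arity and a modulus
of uniform continuity, and constant symbols. -/
structure MetricSignature where
  /-- function symbols -/
  Func : Type u
  /-- arity of a function symbol -/
  funcArity : Func → ℕ
  /-- modulus of uniform continuity of a function symbol -/
  funcModulus : Func → UCModulus
  /-- predicate symbols -/
  Pred : Type v
  /-- arity of a predicate symbol -/
  predArity : Pred → ℕ
  /-- modulus of uniform continuity of a predicate symbol -/
  predModulus : Pred → UCModulus
  /-- constant symbols -/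
  Const : Type w

/-- The structure of an `S`-structure on the metric space `M`. The distance on a finite power
`Fin n → M` is the maximum of the coordinate distances. -/
structure MetricStructure (S : MetricSignature.{u, v, w}) (M : Type x) [MetricSpace M] where
  /-- the diameter is at most `1` -/
  dist_le_one : ∀ a b : M, dist a b ≤ 1
  /-- interpretation of the function symbols -/
  func : ∀ f : S.Func, (Fin (S.funcArity f) → M) → M
  /-- the function symbols obey their moduli of uniform continuity -/
  func_modulus : ∀ (f : S.Func) (ε : Set.Ioo (0 : ℚ) 1) (a b : Fin (S.funcArity f) → M),
    dist a b < ((S.funcModulus f ε : ℚ) : ℝ) → dist (func f a) (func f b) ≤ ((ε : ℚ) : ℝ)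
  /-- interpretation of the predicate symbols, with values in `[0,1]` -/
  pred : ∀ p : S.Pred, (Fin (S.predArity p) → M) → unitInterval
  /-- the predicate symbols obey their moduli of uniform continuity -/
  pred_modulus : ∀ (p : S.Pred) (ε : Set.Ioo (0 : ℚ) 1) (a b : Fin (S.predArity p) → M),
    dist a b < ((S.predModulus p ε : ℚ) : ℝ) →
      |(pred p a : ℝ) - (pred p b : ℝ)| ≤ ((ε : ℚ) : ℝ)
  /-- interpretation of the constant symbols -/
  const : S.Const → M

namespace MetricSignature

/-- Terms with variables among `x₀, …, xₙ₋₁`. -/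
inductive Term (S : MetricSignature.{u, v, w}) (n : ℕ) : Type (max u w)
  | var (i : Fin n) : Term S n
  | const (c : S.Const) : Term S n
  | func (f : S.Func) (t : Fin (S.funcArity f) → Term S n) : Term S n

/-- Formulas of the (possibly discontinuous) infinitary logic `L_{ω₁,ω}` with free variables among
`x₀, …, xₙ₋₁`: the countable `sup` and `inf` are subject to no continuity requirement, only to all
members having their free variables in one finite set. A quantifier binds the variable with the
last index of its scope. -/
inductive Formula (S : MetricSignature.{u, v, w}) : ℕ → Type (max u v w)
  /-- `d(t₁, t₂)` -/
  | dist {n : ℕ} (t₁ t₂ : S.Term n) : Formula S n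
  /-- `P(t₁, …, tₘ)` -/
  | pred {n : ℕ} (p : S.Pred) (t : Fin (S.predArity p) → S.Term n) : Formula S n
  /-- `f(φ₁, …, φₖ)` for a continuous `f : [0,1]ᵏ → [0,1]` -/
  | conn {n k : ℕ} (f : C(Fin k → unitInterval, unitInterval)) (φ : Fin k → Formula S n) :
      Formula S n
  /-- `sup_x φ` -/
  | supVar {n : ℕ} (φ : Formula S (n + 1)) : Formula S n
  /-- `inf_x φ` -/
  | infVar {n : ℕ} (φ : Formula S (n + 1)) : Formula S n
  /-- `sup_{i < ω} φᵢ` -/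
  | supSeq {n : ℕ} (φ : ℕ → Formula S n) : Formula S n
  /-- `inf_{i < ω} φᵢ` -/
  | infSeq {n : ℕ} (φ : ℕ → Formula S n) : Formula S n

end MetricSignature

namespace MetricStructure

variable {S : MetricSignature.{u, v, w}} {M : Type x} [MetricSpace M]

/-- The value of a term at a tuple. -/
def termValue (𝓜 : MetricStructure S M) {n : ℕ} (a : Fin n → M) : S.Term n → M
  | .var i => a i
  | .const c => 𝓜.const c
  | .func f t => 𝓜.func f fun i => 𝓜.termValue a (t i)

/-- The value `φ^M(a) ∈ [0,1]` of a formula at a tuple. Suprema and infima are taken in `[0,1]`. -/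
noncomputable def value (𝓜 : MetricStructure S M) :
    {n : ℕ} → S.Formula n → (Fin n → M) → unitInterval
  | _, .dist t₁ t₂, a =>
      ⟨dist (𝓜.termValue a t₁) (𝓜.termValue a t₂), dist_nonneg, 𝓜.dist_le_one _ _⟩
  | _, .pred p t, a => 𝓜.pred p fun i => 𝓜.termValue a (t i)
  | _, .conn f φ, a => f fun i => 𝓜.value (φ i) a
  | _, .supVar φ, a => ⨆ b : M, 𝓜.value φ (Fin.snoc (α := fun _ => M) a b)
  | _, .infVar φ, a => ⨅ b : M, 𝓜.value φ (Fin.snoc (α := fun _ => M) a b)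
  | _, .supSeq φ, a => ⨆ i : ℕ, 𝓜.value (φ i) a
  | _, .infSeq φ, a => ⨅ i : ℕ, 𝓜.value (φ i) a

/-- An automorphism: an isometric bijection of `M` onto itself that preserves the interpretations
of all symbols. -/
structure IsAutomorphism (𝓜 : MetricStructure S M) (Φ : M ≃ᵢ M) : Prop where
  map_func : ∀ (f : S.Func) (a : Fin (S.funcArity f) → M),
    Φ (𝓜.func f a) = 𝓜.func f fun i => Φ (a i)
  map_pred : ∀ (p : S.Pred) (a : Fin (S.predArity p) → M),
    (𝓜.pred p fun i => Φ (a i)) = 𝓜.pred p a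
  map_const : ∀ c : S.Const, Φ (𝓜.const c) = 𝓜.const c

end MetricStructure

/-! Automorphisms preserve every formula, by induction. For the converse, `logicDist a b` is the
supremum of `|f a - f b|` over definable 1-Lipschitz `f`. By Lindelöf, countably many `f` suffice,
so `logicDist a` is itself definable and 1-Lipschitz (`definableLipschitz_logicDist`). Taking infima
of it over one more variable gives the forth property; inf-convolving an arbitrary definable
function with the metric lets one reduce a small logic distance further by a small metric
perturbation (`exists_dist_lt_and_lt`). A back-and-forth with geometrically decreasing errors then
yields `exists_isAutomorphism_dist_le`: tuples at logic distance below `ε` are matched up to `2 * ε`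
by an automorphism. An invariant continuous `P` is therefore the supremum over `N` of its
`N`-Lipschitz envelopes for `logicDist`, each a countable infimum of definable functions. -/

open Filter Topology Set

namespace MetricStructure

variable {S : MetricSignature.{u, v, w}} {M : Type x} [MetricSpace M] {𝓜 : MetricStructure S M}

/-! ### Invariance of values under automorphisms -/

theorem IsAutomorphism.termValue_map {Φ : M ≃ᵢ M} (hΦ : 𝓜.IsAutomorphism Φ) {n : ℕ}
    (a : Fin n → M) (t : S.Term n) :
    𝓜.termValue (fun i => Φ (a i)) t = Φ (𝓜.termValue a t) := by
  induction t with
  | var i => rfl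
  | const c => exact (hΦ.map_const c).symm
  | func f t ih => simp only [termValue, ih, hΦ.map_func]

/-- Automorphisms preserve the values of all formulas. -/
theorem IsAutomorphism.value_map {Φ : M ≃ᵢ M} (hΦ : 𝓜.IsAutomorphism Φ) {n : ℕ}
    (φ : S.Formula n) (a : Fin n → M) : 𝓜.value φ (fun i => Φ (a i)) = 𝓜.value φ a := by
  have hsnoc : ∀ {n : ℕ} (a : Fin n → M) (b : M),
      Fin.snoc (α := fun _ => M) (fun i => Φ (a i)) (Φ b) =
        fun i => Φ (Fin.snoc (α := fun _ => M) a b i) := by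
    intro n a b
    exact (Fin.comp_snoc Φ a b).symm
  induction φ with
  | dist t₁ t₂ => simp only [value, hΦ.termValue_map, Φ.dist_eq]
  | pred p t => simp only [value, hΦ.termValue_map, hΦ.map_pred]
  | conn f φ ih => simp only [value, ih]
  | supVar φ ih =>
    simp only [value]
    rw [← Φ.surjective.iSup_comp]
    simp only [hsnoc, ih]
  | infVar φ ih =>
    simp only [value]
    rw [← Φ.surjective.iInf_comp]
    simp only [hsnoc, ih]
  | supSeq φ ih => simp only [value, ih]
  | infSeq φ ih => simp only [value, ih]

/-! ### Closure properties of definable functions -/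

/-- A function on `Mⁿ` that is the value of a formula. -/
def Definable (𝓜 : MetricStructure S M) {n : ℕ} (f : (Fin n → M) → unitInterval) : Prop :=
  ∃ φ : S.Formula n, ∀ a, 𝓜.value φ a = f a

theorem Definable.conn {n k : ℕ} {f : Fin k → (Fin n → M) → unitInterval}
    (hf : ∀ i, 𝓜.Definable (f i)) (g : C(Fin k → unitInterval, unitInterval)) :
    𝓜.Definable fun a => g fun i => f i a := by
  choose φ hφ using hf
  exact ⟨.conn g φ, fun a => by simp only [value, hφ]⟩

theorem Definable.const {n : ℕ} (c : unitInterval) :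
    𝓜.Definable fun _ : Fin n → M => c :=
  Definable.conn (k := 0) (f := fun _ _ => c) (fun i => i.elim0) (ContinuousMap.const _ c)

theorem Definable.comp {n : ℕ} {f : (Fin n → M) → unitInterval} (hf : 𝓜.Definable f)
    {g : unitInterval → unitInterval} (hg : Continuous g) : 𝓜.Definable fun a => g (f a) :=
  Definable.conn (k := 1) (f := fun _ => f) (fun _ => hf) ⟨fun x => g (x 0), by fun_prop⟩

theorem Definable.comp₂ {n : ℕ} {f₁ f₂ : (Fin n → M) → unitInterval} (hf₁ : 𝓜.Definable f₁)
    (hf₂ : 𝓜.Definable f₂) {g : unitInterval × unitInterval → unitInterval}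
    (hg : Continuous g) : 𝓜.Definable fun a => g (f₁ a, f₂ a) :=
  Definable.conn (k := 2) (f := ![f₁, f₂]) (Fin.forall_fin_two.2 ⟨hf₁, hf₂⟩)
    ⟨fun x => g (x 0, x 1), by fun_prop⟩

theorem Definable.iSup {n : ℕ} {ι : Type*} [Countable ι] {f : ι → (Fin n → M) → unitInterval}
    (hf : ∀ i, 𝓜.Definable (f i)) : 𝓜.Definable fun a => ⨆ i, f i a := by
  rcases isEmpty_or_nonempty ι with h | h
  · simp only [iSup_of_empty]
    exact Definable.const _
  · obtain ⟨e, he⟩ := exists_surjective_nat ι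
    choose φ hφ using hf
    exact ⟨.supSeq fun k => φ (e k), fun a => by
      simp only [value, hφ]; exact he.iSup_comp fun i => f i a⟩

theorem Definable.iInf {n : ℕ} {ι : Type*} [Countable ι] {f : ι → (Fin n → M) → unitInterval}
    (hf : ∀ i, 𝓜.Definable (f i)) : 𝓜.Definable fun a => ⨅ i, f i a := by
  rcases isEmpty_or_nonempty ι with h | h
  · simp only [iInf_of_empty]
    exact Definable.const _
  · obtain ⟨e, he⟩ := exists_surjective_nat ι
    choose φ hφ using hf
    exact ⟨.infSeq fun k => φ (e k), fun a => by
      simp only [value, hφ]; exact he.iInf_comp fun i => f i a⟩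

theorem Definable.iInf_snoc {n : ℕ} {f : (Fin (n + 1) → M) → unitInterval}
    (hf : 𝓜.Definable f) :
    𝓜.Definable fun a : Fin n → M => ⨅ b : M, f (Fin.snoc (α := fun _ => M) a b) := by
  obtain ⟨φ, hφ⟩ := hf
  exact ⟨.infVar φ, fun a => by simp only [value, hφ]⟩

theorem Definable.iInf_append {n : ℕ} : ∀ {m : ℕ} {f : (Fin (n + m) → M) → unitInterval},
    𝓜.Definable f → 𝓜.Definable fun a : Fin n → M => ⨅ z : Fin m → M, f (Fin.append a z)
  | 0, f, hf => by
    have h : (fun a : Fin n → M => ⨅ z : Fin 0 → M, f (Fin.append a z)) = f := by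
      funext a
      rw [iInf_unique, Fin.append_right_nil _ _ rfl]
      rfl
    exact (congrArg 𝓜.Definable h).mpr hf
  | m + 1, f, hf => by
    have h := Definable.iInf_append (m := m) (Definable.iInf_snoc (n := n + m) hf)
    convert h using 2 with a
    apply le_antisymm
    · refine le_iInf fun z => le_iInf fun b => ?_
      rw [← Fin.append_snoc]
      exact iInf_le _ _
    · refine le_iInf fun z => ?_
      rw [← Fin.snoc_init_self z, Fin.append_snoc]
      exact (iInf_le _ _).trans (iInf_le _ _)

theorem exists_term_reindex {n m : ℕ} (σ : Fin n → Fin m) (t : S.Term n) :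
    ∃ t' : S.Term m, ∀ (𝓜 : MetricStructure S M) (a : Fin m → M),
      𝓜.termValue a t' = 𝓜.termValue (fun i => a (σ i)) t := by
  induction t with
  | var i => exact ⟨.var (σ i), fun _ _ => rfl⟩
  | const c => exact ⟨.const c, fun _ _ => rfl⟩
  | func f t ih =>
    choose t' ht' using ih
    exact ⟨.func f t', fun 𝓜 a => by simp only [termValue, ht']⟩

theorem _root_.Fin.snoc_reindex {α : Type*} {n m : ℕ} (σ : Fin n → Fin m) (a : Fin m → α) (b : α) :
    (fun i => Fin.snoc (α := fun _ => α) a b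
      (Fin.snoc (α := fun _ => Fin (m + 1)) (fun j => (σ j).castSucc) (Fin.last m) i)) =
      Fin.snoc (α := fun _ => α) (fun i => a (σ i)) b := by
  funext i
  refine Fin.lastCases ?_ (fun j => ?_) i <;> simp

/-- Renaming the variables of a formula. -/
theorem exists_formula_reindex {n : ℕ} (φ : S.Formula n) {m : ℕ} (σ : Fin n → Fin m) :
    ∃ φ' : S.Formula m, ∀ a, 𝓜.value φ' a = 𝓜.value φ fun i => a (σ i) := by
  induction φ generalizing m with
  | dist t₁ t₂ =>
    obtain ⟨t₁', h₁⟩ := exists_term_reindex (M := M) σ t₁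
    obtain ⟨t₂', h₂⟩ := exists_term_reindex (M := M) σ t₂
    exact ⟨.dist t₁' t₂', fun a => by simp only [value, h₁, h₂]⟩
  | pred p t =>
    choose t' ht' using fun i => exists_term_reindex (M := M) σ (t i)
    exact ⟨.pred p t', fun a => by simp only [value, ht']⟩
  | conn f φ ih =>
    choose φ' h using fun i => ih i σ
    exact ⟨.conn f φ', fun a => by simp only [value, h]⟩
  | supVar φ ih =>
    -- The bound variable has the last index, so the renaming is extended by last to last.
    obtain ⟨φ', h⟩ := ih (Fin.snoc (α := fun _ => Fin (m + 1)) (fun j => (σ j).castSucc)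
      (Fin.last m))
    exact ⟨.supVar φ', fun a => by simp only [value, h, Fin.snoc_reindex]⟩
  | infVar φ ih =>
    obtain ⟨φ', h⟩ := ih (Fin.snoc (α := fun _ => Fin (m + 1)) (fun j => (σ j).castSucc)
      (Fin.last m))
    exact ⟨.infVar φ', fun a => by simp only [value, h, Fin.snoc_reindex]⟩
  | supSeq φ ih =>
    choose φ' h using fun i => ih i σ
    exact ⟨.supSeq φ', fun a => by simp only [value, h]⟩
  | infSeq φ ih =>
    choose φ' h using fun i => ih i σ
    exact ⟨.infSeq φ', fun a => by simp only [value, h]⟩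

theorem Definable.reindex {n m : ℕ} {f : (Fin n → M) → unitInterval} (hf : 𝓜.Definable f)
    (σ : Fin n → Fin m) : 𝓜.Definable fun a : Fin m → M => f fun i => a (σ i) := by
  obtain ⟨φ, hφ⟩ := hf
  obtain ⟨φ', h⟩ := exists_formula_reindex (𝓜 := 𝓜) φ σ
  exact ⟨φ', fun a => by rw [h, hφ]⟩

/-! ### Distances and Lipschitz definable functions -/

/-- The distance of two points as an element of `[0,1]`. -/
def unitDist (𝓜 : MetricStructure S M) (a b : M) : unitInterval :=
  ⟨dist a b, dist_nonneg, 𝓜.dist_le_one a b⟩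

/-- The distance of two tuples as an element of `[0,1]`. -/
def tupleDist (𝓜 : MetricStructure S M) {n : ℕ} (a b : Fin n → M) : unitInterval :=
  ⟨dist a b, dist_nonneg, (dist_pi_le_iff zero_le_one).2 fun _ => 𝓜.dist_le_one _ _⟩

theorem tupleDist_eq_iSup {n : ℕ} (a b : Fin n → M) :
    𝓜.tupleDist a b = ⨆ i, 𝓜.unitDist (a i) (b i) := by
  apply le_antisymm
  · refine Subtype.coe_le_coe.1 ((dist_pi_le_iff (⨆ i, 𝓜.unitDist (a i) (b i)).2.1).2
      fun i => ?_)
    exact Subtype.coe_le_coe.2 (le_iSup (fun i => 𝓜.unitDist (a i) (b i)) i)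
  · exact iSup_le fun i => Subtype.coe_le_coe.1 (dist_le_pi_dist a b i)

theorem Definable.unitDist {n : ℕ} (t₁ t₂ : S.Term n) :
    𝓜.Definable fun a => 𝓜.unitDist (𝓜.termValue a t₁) (𝓜.termValue a t₂) :=
  ⟨.dist t₁ t₂, fun _ => rfl⟩

theorem Definable.tupleDist {n m : ℕ} (σ τ : Fin m → Fin n) :
    𝓜.Definable fun a : Fin n → M => 𝓜.tupleDist (fun i => a (σ i)) (fun i => a (τ i)) := by
  simp only [tupleDist_eq_iSup]
  exact Definable.iSup fun i => Definable.unitDist (.var (σ i)) (.var (τ i))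

/-- Definable functions that are `1`-Lipschitz for the maximum distance on tuples. -/
structure DefinableLipschitz (𝓜 : MetricStructure S M) {n : ℕ}
    (f : (Fin n → M) → unitInterval) : Prop where
  definable : 𝓜.Definable f
  le_add_dist : ∀ a b, (f a : ℝ) ≤ f b + dist a b

theorem DefinableLipschitz.abs_sub_le {n : ℕ} {f : (Fin n → M) → unitInterval}
    (hf : 𝓜.DefinableLipschitz f) (a b : Fin n → M) : |(f a : ℝ) - f b| ≤ dist a b := by
  rw [abs_sub_le_iff]
  have h₁ := hf.le_add_dist a b
  have h₂ := hf.le_add_dist b a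
  rw [dist_comm] at h₂
  constructor <;> linarith

theorem DefinableLipschitz.continuous {n : ℕ} {f : (Fin n → M) → unitInterval}
    (hf : 𝓜.DefinableLipschitz f) : Continuous f := by
  refine (LipschitzWith.mk_one fun a b => ?_).continuous
  rw [Subtype.dist_eq, Real.dist_eq]
  exact hf.abs_sub_le a b

/-- The distance of two elements of `[0,1]` as an element of `[0,1]`. -/
def absDiff (s t : unitInterval) : unitInterval :=
  ⟨|(s : ℝ) - t|, abs_nonneg _, abs_sub_le_iff.2
    ⟨by linarith [s.2.2, t.2.1], by linarith [t.2.2, s.2.1]⟩⟩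

@[simp] theorem coe_absDiff (s t : unitInterval) : (absDiff s t : ℝ) = |(s : ℝ) - t| := rfl

theorem continuous_absDiff (s : unitInterval) : Continuous (absDiff s) := by
  unfold absDiff
  fun_prop

/-- If the bound failed, its right side would be below `1`, hence an element of `[0,1]` bounding
every `f i`. An empty supremum is `0`, whence `0 ≤ r`. -/
theorem coe_iSup_le_add {α : Type*} {f g : α → unitInterval} {r : ℝ}
    (h : ∀ i, (f i : ℝ) ≤ g i + r) (hr : 0 ≤ r) : ((⨆ i, f i : unitInterval) : ℝ) ≤
      (⨆ i, g i : unitInterval) + r := by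
  by_contra! hlt
  have h0 : (0 : ℝ) ≤ (⨆ i, g i : unitInterval) := (⨆ i, g i).2.1
  have h1 : ((⨆ i, f i : unitInterval) : ℝ) ≤ 1 := (⨆ i, f i).2.2
  have hle : (⨆ i, f i) ≤ (⟨(⨆ i, g i : unitInterval) + r, by linarith, by linarith⟩ :
      unitInterval) :=
    iSup_le fun i => Subtype.coe_le_coe.1
      ((h i).trans (by simpa using Subtype.coe_le_coe.2 (le_iSup g i)))
  exact absurd (Subtype.coe_le_coe.2 hle) (not_le.2 hlt)

theorem exists_lt_of_coe_iInf_lt {α : Type*} [Nonempty α] {f : α → unitInterval} {r : ℝ}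
    (h : ((⨅ i, f i : unitInterval) : ℝ) < r) : ∃ i, (f i : ℝ) < r := by
  have h' := Set.Icc.coe_iInf (zero_le_one' ℝ) (S := f)
  exact exists_lt_of_ciInf_lt (h'.symm.trans_lt h)

theorem coe_iInf_le_add {α : Type*} [Nonempty α] {f g : α → unitInterval} {r : ℝ}
    (h : ∀ i, (f i : ℝ) ≤ g i + r) : ((⨅ i, f i : unitInterval) : ℝ) ≤
      (⨅ i, g i : unitInterval) + r := by
  by_contra! hlt
  obtain ⟨i, hi⟩ := exists_lt_of_coe_iInf_lt (lt_sub_iff_add_lt.2 hlt)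
  have h1 : ((⨅ i, f i : unitInterval) : ℝ) ≤ f i := Subtype.coe_le_coe.2 (iInf_le f i)
  linarith [h i]

/-! ### The logic distance -/

/-- The pseudometric on tuples given by all definable `1`-Lipschitz functions. -/
noncomputable def logicDist (𝓜 : MetricStructure S M) {n : ℕ} (a b : Fin n → M) :
    unitInterval :=
  ⨆ f : {f : (Fin n → M) → unitInterval // 𝓜.DefinableLipschitz f}, absDiff (f.1 a) (f.1 b)

theorem logicDist_self {n : ℕ} (a : Fin n → M) : 𝓜.logicDist a a = 0 := by
  refine le_antisymm (iSup_le fun f => ?_) unitInterval.nonneg'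
  rw [← Subtype.coe_le_coe]
  simp

theorem logicDist_comm {n : ℕ} (a b : Fin n → M) : 𝓜.logicDist a b = 𝓜.logicDist b a := by
  unfold logicDist
  congr 1
  funext f
  exact Subtype.ext (abs_sub_comm _ _)

theorem DefinableLipschitz.abs_sub_le_logicDist {n : ℕ} {f : (Fin n → M) → unitInterval}
    (hf : 𝓜.DefinableLipschitz f) (a b : Fin n → M) :
    |(f a : ℝ) - f b| ≤ 𝓜.logicDist a b :=
  Subtype.coe_le_coe.2 (le_iSup (fun f : {f : (Fin n → M) → unitInterval //
    𝓜.DefinableLipschitz f} => absDiff (f.1 a) (f.1 b)) ⟨f, hf⟩)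

theorem logicDist_le_add_dist {n : ℕ} (a b c : Fin n → M) :
    (𝓜.logicDist a b : ℝ) ≤ 𝓜.logicDist a c + dist b c := by
  refine coe_iSup_le_add (fun f => ?_) dist_nonneg
  have h := f.2.abs_sub_le c b
  rw [dist_comm]
  exact (abs_sub_le _ (f.1 c : ℝ) _).trans (by simpa using h)

theorem logicDist_le_dist {n : ℕ} (a b : Fin n → M) : (𝓜.logicDist a b : ℝ) ≤ dist a b := by
  have h := 𝓜.logicDist_le_add_dist a b a
  rwa [logicDist_self, dist_comm, Icc.coe_zero, zero_add] at h

/-- For each rational `q` the open sets where `|f a - f b| > q` have a countable subfamily with the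
same union, as `Mⁿ × Mⁿ` is second countable. The subfamilies for all `q` together recover the
supremum. -/
theorem exists_countable_logicDist_eq [TopologicalSpace.SeparableSpace M]
    (𝓜 : MetricStructure S M) (n : ℕ) :
    ∃ T : Set {f : (Fin n → M) → unitInterval // 𝓜.DefinableLipschitz f}, T.Countable ∧
      ∀ a b, 𝓜.logicDist a b = ⨆ f : T, absDiff (f.1.1 a) (f.1.1 b) := by
  have : SecondCountableTopology M := UniformSpace.secondCountable_of_separable M
  have hcover : ∀ q : ℚ, ∃ T : Set {f : (Fin n → M) → unitInterval // 𝓜.DefinableLipschitz f},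
      T.Countable ∧ ⋃ f ∈ T, {p : (Fin n → M) × (Fin n → M) |
        (q : ℝ) < |(f.1 p.1 : ℝ) - f.1 p.2|} =
          ⋃ f : {f : (Fin n → M) → unitInterval // 𝓜.DefinableLipschitz f},
        {p : (Fin n → M) × (Fin n → M) |
          (q : ℝ) < |(f.1 p.1 : ℝ) - f.1 p.2|} := by
    intro q
    refine TopologicalSpace.isOpen_iUnion_countable _ fun f => ?_
    have hc := f.2.continuous
    exact isOpen_lt continuous_const (by fun_prop)
  choose T hT hTq using hcover
  refine ⟨⋃ q, T q, countable_iUnion hT, fun a b => le_antisymm (iSup_le fun f => ?_)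
    (iSup_le fun f => le_iSup (fun f : {f : (Fin n → M) → unitInterval //
      𝓜.DefinableLipschitz f} => absDiff (f.1 a) (f.1 b)) f.1)⟩
  by_contra! hlt
  obtain ⟨q, hq₁, hq₂⟩ := exists_rat_btwn (Subtype.coe_lt_coe.2 hlt)
  have hmem : (a, b) ∈ ⋃ f : {f : (Fin n → M) → unitInterval // 𝓜.DefinableLipschitz f},
      {p : (Fin n → M) × (Fin n → M) | (q : ℝ) < |(f.1 p.1 : ℝ) - f.1 p.2|} :=
    mem_iUnion.2 ⟨f, hq₂⟩
  rw [← hTq, mem_iUnion₂] at hmem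
  obtain ⟨g, hg, hgq⟩ := hmem
  have hle := le_iSup (fun f : (⋃ q, T q : Set _) => absDiff (f.1.1 a) (f.1.1 b))
    ⟨g, mem_iUnion.2 ⟨q, hg⟩⟩
  exact absurd (hgq.trans_le (Subtype.coe_le_coe.2 hle)) (not_lt.2 hq₁.le)

/-- The tuple `a` enters only through the real numbers `f a`, which are absorbed into connectives,
so no parameters are needed. -/
theorem definableLipschitz_logicDist [TopologicalSpace.SeparableSpace M] {n : ℕ}
    (a : Fin n → M) : 𝓜.DefinableLipschitz (𝓜.logicDist a) := by
  refine ⟨?_, fun b c => logicDist_le_add_dist a b c⟩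
  obtain ⟨T, hT, h⟩ := 𝓜.exists_countable_logicDist_eq n
  have := hT.to_subtype
  simp only [funext fun b => h a b]
  exact Definable.iSup fun f => f.1.2.definable.comp (continuous_absDiff _)

theorem logicDist_reindex_le {n m : ℕ} (σ : Fin m → Fin n) (a b : Fin n → M) :
    𝓜.logicDist (fun i => a (σ i)) (fun i => b (σ i)) ≤ 𝓜.logicDist a b := by
  refine iSup_le fun f => ?_
  have hf : 𝓜.DefinableLipschitz fun a : Fin n → M => f.1 fun i => a (σ i) := by
    refine ⟨f.2.definable.reindex σ, fun a b => (f.2.le_add_dist _ (fun i => b (σ i))).trans ?_⟩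
    gcongr
    exact (dist_pi_le_iff dist_nonneg).2 fun i => dist_le_pi_dist a b (σ i)
  exact Subtype.coe_le_coe.1 (hf.abs_sub_le_logicDist a b)

/-! ### Transfer between tuples at small logic distance -/

/-- The forth step. -/
theorem exists_logicDist_snoc_lt [TopologicalSpace.SeparableSpace M] {n : ℕ} {a b : Fin n → M}
    {ε : ℝ} (h : (𝓜.logicDist a b : ℝ) < ε) (c : M) :
    ∃ d : M, (𝓜.logicDist (Fin.snoc (α := fun _ => M) a c)
      (Fin.snoc (α := fun _ => M) b d) : ℝ) < ε := by
  have : Nonempty M := ⟨c⟩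
  let ψ : (Fin n → M) → unitInterval := fun y =>
    ⨅ d : M, 𝓜.logicDist (Fin.snoc (α := fun _ => M) a c) (Fin.snoc (α := fun _ => M) y d)
  have hψ : 𝓜.DefinableLipschitz ψ := by
    refine ⟨(definableLipschitz_logicDist _).definable.iInf_snoc,
      fun y z => coe_iInf_le_add fun d => (logicDist_le_add_dist _ _
        (Fin.snoc (α := fun _ => M) z d)).trans ?_⟩
    gcongr
    refine (dist_pi_le_iff dist_nonneg).2 fun i => ?_
    refine Fin.lastCases ?_ (fun j => ?_) i
    · simp
    · simpa using dist_le_pi_dist y z j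
  have hψa : ψ a = 0 := le_antisymm ((iInf_le _ c).trans_eq (logicDist_self _))
    unitInterval.nonneg'
  have hψb := hψ.abs_sub_le_logicDist a b
  rw [hψa, Icc.coe_zero, zero_sub, abs_neg] at hψb
  exact exists_lt_of_coe_iInf_lt (((le_abs_self _).trans hψb).trans_lt h)

/-- A definable function that vanishes at `a` is small at some tuple close to `b` if `b` is close
to `a` in the logic distance. -/
theorem exists_dist_lt_and_lt [TopologicalSpace.SeparableSpace M] {n : ℕ}
    {f : (Fin n → M) → unitInterval} (hf : 𝓜.Definable f) {a b : Fin n → M} (hfa : f a = 0)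
    {ε δ : ℝ} (h : (𝓜.logicDist a b : ℝ) < ε) (hδ : 0 < δ) :
    ∃ b', dist b b' < ε ∧ (f b' : ℝ) < δ := by
  -- For `ε > 1` the diameter bound makes `a` itself a witness; for `ε ≤ 1` the truncation at `1` in
  -- `g` below does no harm.
  rcases lt_or_ge 1 ε with hε | hε
  · exact ⟨a, (𝓜.tupleDist b a).2.2.trans_lt hε, by rw [hfa]; exact hδ⟩
  obtain ⟨N, hN⟩ := exists_nat_gt δ⁻¹
  have hN0 : (0 : ℝ) < N := (inv_pos.2 hδ).trans hN
  let g : unitInterval × unitInterval → unitInterval := fun p =>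
    projIcc 0 1 zero_le_one (N * (p.1 : ℝ) + p.2)
  have hg : Continuous g := by
    have := continuous_projIcc (h := zero_le_one' ℝ)
    fun_prop
  have : Nonempty (Fin n → M) := ⟨a⟩
  -- Inf-convolution of `N * f` with the metric: it is 1-Lipschitz even where `f` is discontinuous,
  -- and vanishes at `a`.
  let ψ : (Fin n → M) → unitInterval := fun y => ⨅ z, g (f z, 𝓜.tupleDist y z)
  have hψ : 𝓜.DefinableLipschitz ψ := by
    constructor
    · have hd := Definable.iInf_append (n := n) (m := n) (Definable.comp₂
        (hf.reindex (Fin.natAdd n)) (Definable.tupleDist (Fin.castAdd n) (Fin.natAdd n)) hg)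
      simpa only [Fin.append_left, Fin.append_right] using hd
    · refine fun y z => coe_iInf_le_add fun c => ?_
      simp only [g, coe_projIcc, tupleDist]
      have h1 := dist_triangle y z c
      have h2 : (0 : ℝ) ≤ dist y z := dist_nonneg
      rcases max_cases (0 : ℝ) (min 1 (N * (f c : ℝ) + dist y c)) with h | h <;>
      rcases max_cases (0 : ℝ) (min 1 (N * (f c : ℝ) + dist z c)) with h' | h' <;>
      rcases min_cases (1 : ℝ) (N * (f c : ℝ) + dist y c) with h'' | h'' <;>
      rcases min_cases (1 : ℝ) (N * (f c : ℝ) + dist z c) with h''' | h''' <;> linarith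
  have hψa : ψ a = 0 := by
    refine le_antisymm ((iInf_le _ a).trans_eq (Subtype.ext ?_)) unitInterval.nonneg'
    simp [g, hfa, tupleDist]
  have hψb := hψ.abs_sub_le_logicDist a b
  rw [hψa, Icc.coe_zero, zero_sub, abs_neg] at hψb
  obtain ⟨b', hb'⟩ := exists_lt_of_coe_iInf_lt (((le_abs_self _).trans hψb).trans_lt h)
  have hb : N * (f b' : ℝ) + dist b b' < ε := by
    simp only [g, coe_projIcc, tupleDist] at hb'
    have := (le_max_right _ _).trans_lt hb'
    rcases min_lt_iff.1 this with h | h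
    · linarith
    · exact h
  have hfb : (0 : ℝ) ≤ f b' := (f b').2.1
  refine ⟨b', by nlinarith, ?_⟩
  have h1 : N * (f b' : ℝ) < 1 := by
    have : (0 : ℝ) ≤ dist b b' := dist_nonneg
    linarith
  have h2 : 1 < N * δ := by
    rwa [inv_lt_iff_one_lt_mul₀ hδ] at hN
  exact lt_of_mul_lt_mul_left (h1.trans h2) hN0.le

/-- Tuples at logic distance zero satisfy the same continuous definable functions. -/
theorem Definable.eq_of_logicDist_eq_zero [TopologicalSpace.SeparableSpace M] {n : ℕ}
    {f : (Fin n → M) → unitInterval} (hf : 𝓜.Definable f) (hc : Continuous f)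
    {a b : Fin n → M} (h : 𝓜.logicDist a b = 0) : f a = f b := by
  have hd : 𝓜.Definable fun y => absDiff (f a) (f y) := hf.comp (continuous_absDiff _)
  -- Points tending to `b` along which `f` tends to `f a`; continuity of `f` at `b` concludes.
  have hclose : ∀ k : ℕ, ∃ b', dist b b' < 1 / ((k : ℝ) + 1) ∧
      (absDiff (f a) (f b') : ℝ) < 1 / ((k : ℝ) + 1) := fun k =>
    exists_dist_lt_and_lt (a := a) hd (Subtype.ext (by simp)) (by rw [h]; simpa using by positivity)
      (by positivity)
  choose z hz₁ hz₂ using hclose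
  have hlim : Tendsto z atTop (𝓝 b) := by
    rw [tendsto_iff_dist_tendsto_zero]
    refine squeeze_zero (fun _ => dist_nonneg) (fun k => ?_) tendsto_one_div_add_atTop_nhds_zero_nat
    rw [dist_comm]
    exact (hz₁ k).le
  have hlim' : Tendsto (fun k => f (z k)) atTop (𝓝 (f a)) := by
    rw [tendsto_iff_dist_tendsto_zero]
    refine squeeze_zero (fun _ => dist_nonneg) (fun k => ?_) tendsto_one_div_add_atTop_nhds_zero_nat
    rw [dist_comm]
    exact (hz₂ k).le
  exact tendsto_nhds_unique hlim' ((hc.tendsto b).comp hlim)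

/-! ### Automorphisms from dense sequences -/

/-- Two dense families with the same mutual distances are related by an isometry. -/
theorem exists_isometryEquiv_of_denseRange [CompleteSpace M] {ι : Type*} {c e : ι → M}
    (hc : DenseRange c) (he : DenseRange e) (h : ∀ i j, dist (c i) (c j) = dist (e i) (e j)) :
    ∃ Φ : M ≃ᵢ M, ∀ i, Φ (c i) = e i := by
  -- With the pseudometric pulled back along `c`, both `c` and `e` exhibit `M` as the completion of
  -- `ι`.
  let _ : PseudoMetricSpace ι := PseudoMetricSpace.induced c inferInstance
  have hci : Isometry c := Isometry.of_dist_eq fun _ _ => rfl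
  have hei : Isometry e := Isometry.of_dist_eq fun i j => (h i j).symm
  let C : AbstractCompletion ι := ⟨M, c, inferInstance, inferInstance, inferInstance,
    hci.isUniformInducing, hc⟩
  let E : AbstractCompletion ι := ⟨M, e, inferInstance, inferInstance, inferInstance,
    hei.isUniformInducing, he⟩
  let F : M ≃ᵤ M := C.compareEquiv E
  have hF : ∀ i, F (c i) = e i := fun i => C.compare_coe E i
  have hFc : Continuous F := F.continuous
  refine ⟨⟨F.toEquiv, Isometry.of_dist_eq fun x y => ?_⟩, hF⟩
  change dist (F x) (F y) = dist x y
  refine DenseRange.induction_on₂ (e := c) (p := fun x y => dist (F x) (F y) = dist x y) hc ?_ ?_ x y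
  · exact isClosed_eq (by fun_prop) (by fun_prop)
  · intro i j
    rw [hF, hF, h]

theorem continuous_func (𝓜 : MetricStructure S M) (f : S.Func) : Continuous (𝓜.func f) := by
  refine Metric.continuous_iff.2 fun b ε hε => ?_
  obtain ⟨q, hq₀, hq₁⟩ := exists_rat_btwn (lt_min hε zero_lt_one)
  obtain ⟨hqε, hq1⟩ := lt_min_iff.1 hq₁
  let η : Ioo (0 : ℚ) 1 := ⟨q, by exact_mod_cast hq₀, by exact_mod_cast hq1⟩
  refine ⟨(S.funcModulus f η : ℚ), by exact_mod_cast (S.funcModulus f η).2.1, fun a ha => ?_⟩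
  exact (𝓜.func_modulus f η a b ha).trans_lt hqε

theorem continuous_pred (𝓜 : MetricStructure S M) (p : S.Pred) : Continuous (𝓜.pred p) := by
  refine Metric.continuous_iff.2 fun b ε hε => ?_
  obtain ⟨q, hq₀, hq₁⟩ := exists_rat_btwn (lt_min hε zero_lt_one)
  obtain ⟨hqε, hq1⟩ := lt_min_iff.1 hq₁
  let η : Ioo (0 : ℚ) 1 := ⟨q, by exact_mod_cast hq₀, by exact_mod_cast hq1⟩
  refine ⟨(S.predModulus p η : ℚ), by exact_mod_cast (S.predModulus p η).2.1, fun a ha => ?_⟩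
  exact (𝓜.pred_modulus p η a b ha).trans_lt hqε

theorem continuous_termValue (𝓜 : MetricStructure S M) {n : ℕ} (t : S.Term n) :
    Continuous fun a => 𝓜.termValue a t := by
  induction t with
  | var i => exact continuous_apply i
  | const c => exact continuous_const
  | func f t ih => exact (𝓜.continuous_func f).comp (continuous_pi ih)

theorem continuous_unitDist_termValue (𝓜 : MetricStructure S M) {n : ℕ} (t₁ t₂ : S.Term n) :
    Continuous fun a => 𝓜.unitDist (𝓜.termValue a t₁) (𝓜.termValue a t₂) := by
  have h₁ := 𝓜.continuous_termValue t₁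
  have h₂ := 𝓜.continuous_termValue t₂
  unfold unitDist
  fun_prop

/-- Two dense sequences that satisfy the same continuous definable functions are related by an
automorphism. -/
theorem exists_isAutomorphism_of_denseRange [CompleteSpace M] {c e : ℕ → M} (hc : DenseRange c)
    (he : DenseRange e) (h : ∀ (k : ℕ) (f : (Fin k → M) → unitInterval), 𝓜.Definable f →
      Continuous f → f (fun i => c i) = f fun i => e i) :
    ∃ Φ : M ≃ᵢ M, 𝓜.IsAutomorphism Φ ∧ ∀ i, Φ (c i) = e i := by
  have hlt : ∀ {k : ℕ} (s : Fin k → ℕ) (j : Fin k), s j < ∑ i, s i + 1 := fun s j =>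
    Nat.lt_succ_of_le (Finset.single_le_sum (fun i _ => Nat.zero_le (s i)) (Finset.mem_univ j))
  have hs : ∀ {k : ℕ} (s : Fin k → ℕ) (f : (Fin k → M) → unitInterval), 𝓜.Definable f →
      Continuous f → f (fun i => c (s i)) = f fun i => e (s i) := by
    intro k s f hf hfc
    exact h _ _ (hf.reindex fun j => ⟨s j, hlt s j⟩) (by fun_prop)
  have hdist : ∀ {k : ℕ} (s : Fin k → ℕ) (t₁ t₂ : S.Term k),
      dist (𝓜.termValue (fun i => c (s i)) t₁) (𝓜.termValue (fun i => c (s i)) t₂) =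
        dist (𝓜.termValue (fun i => e (s i)) t₁) (𝓜.termValue (fun i => e (s i)) t₂) :=
    fun s t₁ t₂ => congrArg Subtype.val
      (hs s _ (Definable.unitDist t₁ t₂) (𝓜.continuous_unitDist_termValue t₁ t₂))
  obtain ⟨Φ, hΦ⟩ := exists_isometryEquiv_of_denseRange hc he fun i j => by
    simpa [termValue] using hdist ![i, j] (.var 0) (.var 1)
  have hterm : ∀ {k : ℕ} (s : Fin k → ℕ) (t : S.Term k),
      Φ (𝓜.termValue (fun i => c (s i)) t) = 𝓜.termValue (fun i => e (s i)) t := by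
    intro k s t
    -- The two term values have matching distances to all `c j` and `e j`, hence to all `y` and `Φ
    -- y`; taking `y` to be the first value gives distance zero.
    have hy : ∀ y, dist (𝓜.termValue (fun i => c (s i)) t) y =
        dist (𝓜.termValue (fun i => e (s i)) t) (Φ y) := by
      intro y
      refine hc.induction_on (p := fun y => dist (𝓜.termValue (fun i => c (s i)) t) y =
        dist (𝓜.termValue (fun i => e (s i)) t) (Φ y)) y ?_ fun j => ?_
      · have := Φ.continuous
        exact isClosed_eq (by fun_prop) (by fun_prop)
      · obtain ⟨t', ht'⟩ := exists_term_reindex (M := M) (Fin.castSucc (n := k)) t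
        have hj := hdist (Fin.snoc (α := fun _ => ℕ) s j) t' (.var (Fin.last k))
        simpa [ht', termValue, hΦ] using hj
    have h0 := hy (𝓜.termValue (fun i => c (s i)) t)
    rw [dist_self] at h0
    exact (dist_eq_zero.1 h0.symm).symm
  have hdense : ∀ {k : ℕ} {p : (Fin k → M) → Prop}, IsClosed {a | p a} →
      (∀ s : Fin k → ℕ, p fun i => c (s i)) → ∀ a, p a := fun hp hps a =>
    (DenseRange.piMap fun _ => hc).induction_on a hp hps
  have hΦc : Continuous Φ := Φ.continuous
  refine ⟨Φ, ⟨fun f => ?_, fun p => ?_, fun k => ?_⟩, hΦ⟩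
  · have hf := 𝓜.continuous_func f
    refine hdense (isClosed_eq (by fun_prop) (by fun_prop)) fun s => ?_
    simpa [termValue, hΦ] using hterm s (.func f fun i => .var i)
  · have hp := 𝓜.continuous_pred p
    refine hdense (isClosed_eq (by fun_prop) (by fun_prop)) fun s => ?_
    simp only [hΦ]
    exact (hs s _ ⟨.pred p fun i => .var i, fun _ => rfl⟩ hp).symm
  · exact hterm (Fin.elim0 : Fin 0 → ℕ) (.const k)

/-! ### Back-and-forth -/

/-- One round of the back-and-forth construction, for sequences of which only the first terms
matter. -/
theorem exists_back_and_forth [TopologicalSpace.SeparableSpace M] {m : ℕ} {a b : ℕ → M} {ε δ : ℝ}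
    (h : (𝓜.logicDist (fun i : Fin m => a i) (fun i : Fin m => b i) : ℝ) < ε) (hδ : 0 < δ)
    (u : M) :
    ∃ a' b' : ℕ → M, (∀ i < m, a' i = a i) ∧ (∀ i < m, dist (b i) (b' i) < ε) ∧ a' m = u ∧
      dist u (b' (m + 1)) < ε ∧
      (𝓜.logicDist (fun i : Fin (m + 2) => a' i) (fun i : Fin (m + 2) => b' i) : ℝ) < δ := by
  obtain ⟨d, hd⟩ := exists_logicDist_snoc_lt h u
  rw [logicDist_comm] at hd
  obtain ⟨c, hc⟩ := exists_logicDist_snoc_lt hd u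
  rw [logicDist_comm] at hc
  -- The tuples are now `(a, u, c)` and `(b, d, u)`. Only the second is perturbed, so the left side
  -- contains `u` exactly and the right side only up to `ε`.
  obtain ⟨z, hz, hzδ⟩ := exists_dist_lt_and_lt (definableLipschitz_logicDist _).definable
    (logicDist_self _) hc hδ
  have hz' : ∀ i, _ := fun i => (dist_le_pi_dist _ _ i).trans_lt hz
  set α : Fin (m + 2) → M := Fin.snoc (α := fun _ => M)
    (Fin.snoc (α := fun _ => M) (fun i : Fin m => a i) u) c with hα
  refine ⟨fun i => if hi : i < m + 2 then α ⟨i, hi⟩ else u,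
    fun i => if hi : i < m + 2 then z ⟨i, hi⟩ else u, fun i hi => ?_, fun i hi => ?_, ?_, ?_, ?_⟩
  · have hi' : i < m + 2 := by omega
    have hαi : α (Fin.castSucc (Fin.castSucc ⟨i, hi⟩)) = a i := by
      rw [hα, Fin.snoc_castSucc, Fin.snoc_castSucc]
    simpa [hi'] using hαi
  · have hi' : i < m + 2 := by omega
    have hzi := hz' (Fin.castSucc (Fin.castSucc ⟨i, hi⟩))
    rw [Fin.snoc_castSucc, Fin.snoc_castSucc] at hzi
    simpa [hi'] using hzi
  · have hαi : α (Fin.castSucc (Fin.last m)) = u := by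
      rw [hα, Fin.snoc_castSucc, Fin.snoc_last]
    simpa [Fin.last] using! hαi
  · have hzi := hz' (Fin.last (m + 1))
    rw [Fin.snoc_last] at hzi
    simpa [Fin.last] using! hzi
  · simpa using hzδ

/-- The tail of the geometric series from `k` is `2 * ε / 2 ^ k`. The threshold `k₀` is there
because a coordinate is controlled only once it has entered the construction. -/
theorem exists_tendsto_of_dist_le_geometric [CompleteSpace M] {x : ℕ → M} {ε : ℝ} {k₀ : ℕ}
    (h : ∀ k ≥ k₀, dist (x k) (x (k + 1)) ≤ ε / 2 ^ k) :
    ∃ l, ∀ k ≥ k₀, dist (x k) l ≤ 2 * ε / 2 ^ k := by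
  have hs : ∀ k₁ ≥ k₀, ∀ k, dist (x (k + k₁)) (x (k + 1 + k₁)) ≤ 2 * ε / 2 ^ k₁ / 2 / 2 ^ k := by
    intro k₁ hk₁ k
    have hk := h (k + k₁) (by omega)
    rw [show k + 1 + k₁ = k + k₁ + 1 by ring]
    convert! hk using 1
    field_simp
    ring
  obtain ⟨l, hl⟩ := cauchySeq_tendsto_of_complete (cauchySeq_of_le_geometric_two (hs k₀ le_rfl))
  rw [tendsto_add_atTop_iff_nat k₀] at hl
  refine ⟨l, fun k hk => ?_⟩
  simpa using dist_le_of_le_geometric_two_of_tendsto (hs k hk)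
    ((tendsto_add_atTop_iff_nat k).2 hl) 0

theorem exists_isAutomorphism_dist_le [CompleteSpace M] [TopologicalSpace.SeparableSpace M]
    {n : ℕ} {a b : Fin n → M} [Nonempty M] {ε : ℝ} (h : (𝓜.logicDist a b : ℝ) < ε) :
    ∃ Φ : M ≃ᵢ M, 𝓜.IsAutomorphism Φ ∧ dist (fun i => Φ (a i)) b ≤ 2 * ε := by
  have hε : 0 < ε := (𝓜.logicDist a b).2.1.trans_lt h
  let Q : ℕ → (ℕ → M) × (ℕ → M) → Prop := fun k s =>
    (𝓜.logicDist (fun i : Fin (n + 2 * k) => s.1 i) (fun i : Fin (n + 2 * k) => s.2 i) : ℝ) <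
      ε / 2 ^ k
  -- Unpairing makes each point of the dense sequence recur at arbitrarily late stages, where the
  -- error on the right side is small.
  let u : ℕ → M := fun k => TopologicalSpace.denseSeq M k.unpair.1
  have step : ∀ (k : ℕ) (s : {s // Q k s}), ∃ s' : {s // Q (k + 1) s},
      (∀ i < n + 2 * k, s'.1.1 i = s.1.1 i) ∧
      (∀ i < n + 2 * k, dist (s.1.2 i) (s'.1.2 i) < ε / 2 ^ k) ∧
      s'.1.1 (n + 2 * k) = u k ∧ dist (u k) (s'.1.2 (n + 2 * k + 1)) < ε / 2 ^ k := by
    intro k s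
    obtain ⟨a', b', h₁, h₂, h₃, h₄, h₅⟩ := exists_back_and_forth s.2
      (show 0 < ε / 2 ^ (k + 1) by positivity) (u k)
    exact ⟨⟨(a', b'), h₅⟩, h₁, h₂, h₃, h₄⟩
  choose next hnext using step
  obtain ⟨o⟩ := ‹Nonempty M›
  let extend : (Fin n → M) → ℕ → M := fun c i => if hi : i < n then c ⟨i, hi⟩ else o
  have hextend : ∀ (c : Fin n → M) (i : Fin n), extend c i = c i := fun c i => by
    simp [extend]
  have hinit : Q 0 (extend a, extend b) := by
    simpa only [Q, hextend, pow_zero, div_one] using! h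
  let s : ∀ k, {s // Q k s} := fun k => Nat.rec ⟨_, hinit⟩ next k
  let A : ℕ → ℕ → M := fun k => (s k).1.1
  let B : ℕ → ℕ → M := fun k => (s k).1.2
  have hA : ∀ k, ∀ i < n + 2 * k, A (k + 1) i = A k i := fun k => (hnext k (s k)).1
  have hB : ∀ k, ∀ i < n + 2 * k, dist (B k i) (B (k + 1) i) ≤ ε / 2 ^ k :=
    fun k i hi => ((hnext k (s k)).2.1 i hi).le
  have hAu : ∀ k, A (k + 1) (n + 2 * k) = u k := fun k => (hnext k (s k)).2.2.1
  have hBu : ∀ k, dist (u k) (B (k + 1) (n + 2 * k + 1)) < ε / 2 ^ k :=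
    fun k => (hnext k (s k)).2.2.2
  have hAB : ∀ k, (𝓜.logicDist (fun i : Fin (n + 2 * k) => A k i) (fun i => B k i) : ℝ) <
      ε / 2 ^ k := fun k => (s k).2
  have hconst : ∀ k i, i < n + 2 * k → ∀ j ≥ k, A j i = A k i := by
    intro k i hi j hj
    induction j, hj using Nat.le_induction with
    | base => rfl
    | succ j hj ih => rw [hA j i (by omega), ih]
  -- Coordinate `i` is settled by stage `i + 1`, since `i < n + 2 * (i + 1)`.
  let c : ℕ → M := fun i => A (i + 1) i
  have hc : ∀ k i, i < n + 2 * k → A k i = c i := by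
    intro k i hi
    rcases le_total k (i + 1) with hk | hk
    · exact (hconst k i hi _ hk).symm
    · exact hconst (i + 1) i (by omega) k hk
  have hlim : ∀ i, ∃ l, ∀ k, i < n + 2 * k → dist (B k i) l ≤ 2 * ε / 2 ^ k := by
    intro i
    rcases lt_or_ge i n with hi | hi
    · obtain ⟨l, hl⟩ := exists_tendsto_of_dist_le_geometric (x := fun k => B k i) (k₀ := 0)
        fun k _ => hB k i (by omega)
      exact ⟨l, fun k _ => hl k (Nat.zero_le k)⟩
    · obtain ⟨l, hl⟩ := exists_tendsto_of_dist_le_geometric (x := fun k => B k i)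
        (k₀ := (i - n) / 2 + 1) fun k hk => hB k i (by omega)
      exact ⟨l, fun k hk => hl k (by omega)⟩
  choose e he using hlim
  have hsmall : ∀ r : ℝ, Tendsto (fun k : ℕ => r / 2 ^ k) atTop (𝓝 0) := fun r =>
    tendsto_const_nhds.div_atTop (tendsto_pow_atTop_atTop_of_one_lt one_lt_two)
  have hzero : ∀ m, 𝓜.logicDist (fun i : Fin m => c i) (fun i => e i) = 0 := by
    intro m
    refine le_antisymm (Subtype.coe_le_coe.1 ?_) unitInterval.nonneg'
    refine ge_of_tendsto (hsmall (ε + 2 * ε)) (eventually_atTop.2 ⟨m, fun k hk => ?_⟩)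
    have h₁ := 𝓜.logicDist_le_add_dist (fun i : Fin m => c i) (fun i => e i) (fun i => B k i)
    have h₂ : dist (fun i : Fin m => e i) (fun i : Fin m => B k i) ≤ 2 * ε / 2 ^ k :=
      (dist_pi_le_iff (by positivity)).2 fun i => by
        rw [dist_comm]; exact he i k (by omega)
    have h₃ : (fun i : Fin m => c i) = fun i : Fin m => A k i :=
      funext fun i => (hc k i (by omega)).symm
    have h₄ := 𝓜.logicDist_reindex_le (Fin.castLE (show m ≤ n + 2 * k by omega))
      (fun i => A k i) (fun i => B k i)
    have h₅ : (𝓜.logicDist (fun i : Fin m => c i) (fun i : Fin m => B k i) : ℝ) ≤ ε / 2 ^ k := by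
      rw [h₃]
      exact (Subtype.coe_le_coe.2 h₄).trans (hAB k).le
    rw [add_div]
    linarith
  have hcd : DenseRange c := by
    refine (TopologicalSpace.denseRange_denseSeq M).mono ?_
    rintro _ ⟨j, rfl⟩
    refine ⟨n + 2 * Nat.pair j 0, ?_⟩
    rw [← hc (Nat.pair j 0 + 1) _ (by omega), hAu]
    simp [u]
  have hed : DenseRange e := by
    refine Metric.denseRange_iff.2 fun y r hr => ?_
    obtain ⟨j, hj⟩ := Metric.denseRange_iff.1 (TopologicalSpace.denseRange_denseSeq M) y (r / 2)
      (half_pos hr)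
    obtain ⟨N, hN⟩ := eventually_atTop.1 ((hsmall (2 * ε)).eventually (gt_mem_nhds (half_pos hr)))
    -- A stage that treats the `j`th dense point and is late enough for the error to be below `r /
    -- 2`.
    have hle : N ≤ Nat.pair j N := Nat.right_le_pair j N
    set k := Nat.pair j N with hk
    refine ⟨n + 2 * k + 1, ?_⟩
    have h₁ := hN k hle
    have h₂ := hBu k
    have h₃ := he (n + 2 * k + 1) (k + 1) (by omega)
    have h₄ : u k = TopologicalSpace.denseSeq M j := by simp [u, hk]
    have h₅ : 2 * ε / 2 ^ (k + 1) = ε / 2 ^ k := by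
      field_simp
      ring
    have h₆ : 2 * ε / 2 ^ k = ε / 2 ^ k + ε / 2 ^ k := by ring
    rw [← h₄] at hj
    have h₇ := dist_triangle4 y (u k) (B (k + 1) (n + 2 * k + 1)) (e (n + 2 * k + 1))
    linarith
  obtain ⟨Φ, hΦ, hce⟩ := exists_isAutomorphism_of_denseRange hcd hed fun k f hf hfc =>
    hf.eq_of_logicDist_eq_zero hfc (hzero k)
  refine ⟨Φ, hΦ, (dist_pi_le_iff (by positivity)).2 fun i => ?_⟩
  have h₁ : a i = c i := by
    rw [← hc 0 i (by omega)]
    exact (hextend a i).symm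
  have h₂ := he i 0 (by omega)
  have h₃ : B 0 i = b i := hextend b i
  rw [h₃, dist_comm, pow_zero, div_one] at h₂
  rwa [h₁, hce]

/-! ### Definability of invariant functions -/

/-- A continuous function on `Mⁿ` invariant under all automorphisms is definable. -/
theorem definable_of_invariant [CompleteSpace M] [TopologicalSpace.SeparableSpace M]
    {n : ℕ} {P : (Fin n → M) → unitInterval} (hP : Continuous P)
    (hinv : ∀ Φ : M ≃ᵢ M, 𝓜.IsAutomorphism Φ → ∀ a, P (fun i => Φ (a i)) = P a) :
    𝓜.Definable P := by
  rcases isEmpty_or_nonempty M with hM | hM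
  · rcases isEmpty_or_nonempty (Fin n → M) with hn | ⟨⟨a⟩⟩
    · exact ⟨.conn (k := 0) (ContinuousMap.const _ 0) Fin.elim0, fun a => hn.elim a⟩
    · have hconst : P = fun _ => P a := funext fun b => congrArg P (Subsingleton.elim b a)
      rw [hconst]
      exact Definable.const _
  have : SecondCountableTopology M := UniformSpace.secondCountable_of_separable M
  let D : ℕ → Fin n → M := TopologicalSpace.denseSeq (Fin n → M)
  let F : ℕ → ℕ → (Fin n → M) → unitInterval := fun N j y =>
    projIcc 0 1 zero_le_one ((P (D j) : ℝ) + N * 𝓜.logicDist (D j) y)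
  have hF : ∀ N j, 𝓜.Definable (F N j) := by
    intro N j
    refine (definableLipschitz_logicDist (D j)).definable.comp
      (g := fun t => projIcc 0 1 zero_le_one ((P (D j) : ℝ) + N * (t : ℝ))) ?_
    have := continuous_projIcc (h := zero_le_one' ℝ)
    fun_prop
  have hcoe : ∀ N j y, (F N j y : ℝ) = min 1 ((P (D j) : ℝ) + N * 𝓜.logicDist (D j) y) := by
    intro N j y
    have h₁ : (0 : ℝ) ≤ P (D j) := (P (D j)).2.1
    have h₂ : (0 : ℝ) ≤ 𝓜.logicDist (D j) y := (𝓜.logicDist (D j) y).2.1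
    simp only [F, coe_projIcc]
    exact max_eq_right (le_min zero_le_one (by positivity))
  have hPF : P = fun y => ⨆ N, ⨅ j, F N j y := by
    funext y
    apply le_antisymm
    · by_contra! hlt
      obtain ⟨q, hq₁, hq₂⟩ := exists_between (Subtype.coe_lt_coe.2 hlt)
      obtain ⟨δ, hδ, hball⟩ := Metric.mem_nhds_iff.1
        (((continuous_subtype_val.comp hP).tendsto y).eventually (lt_mem_nhds hq₂))
      -- This `N` forces the logic distance below `δ / 3`, so an automorphism brings `D j` within `2
      -- * δ / 3` of `y`, where `P > q`; yet `P (D j) < q`.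
      obtain ⟨N, hN⟩ := exists_nat_gt (3 / δ)
      have hsup : ((⨅ j, F N j y : unitInterval) : ℝ) < q :=
        (Subtype.coe_le_coe.2 (le_iSup (fun N => ⨅ j, F N j y) N)).trans_lt hq₁
      obtain ⟨j, hj⟩ := exists_lt_of_coe_iInf_lt hsup
      rw [hcoe] at hj
      have hq1 : q < 1 := hq₂.trans_le (P y).2.2
      have hj' : (P (D j) : ℝ) + N * 𝓜.logicDist (D j) y < q :=
        (min_lt_iff.1 hj).resolve_left (not_lt.2 hq1.le)
      have h₁ : (0 : ℝ) ≤ P (D j) := (P (D j)).2.1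
      have hN' : 3 < N * δ := (div_lt_iff₀ hδ).1 hN
      have hN0 : (0 : ℝ) ≤ N := N.cast_nonneg
      have hsmall : (𝓜.logicDist (D j) y : ℝ) < δ / 3 := by
        by_contra! hge
        nlinarith
      obtain ⟨Φ, hΦ, hdist⟩ := exists_isAutomorphism_dist_le hsmall
      have h₂ : q < P fun i => Φ (D j i) := hball (Metric.mem_ball.2 (by linarith))
      rw [hinv Φ hΦ] at h₂
      have h₃ : (0 : ℝ) ≤ N * 𝓜.logicDist (D j) y :=
        mul_nonneg hN0 (𝓜.logicDist (D j) y).2.1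
      have h₄ : q < P (D j) := h₂
      linarith
    · refine iSup_le fun N => Subtype.coe_le_coe.1 ?_
      have hc : Continuous fun z => (P z : ℝ) + N * dist z y := by fun_prop
      -- For `z = D j` this follows from `logicDist_le_dist`, and for all `z` by density; then `z =
      -- y` is used, which need not be among the `D j`.
      have hle : ∀ z, ((⨅ j, F N j y : unitInterval) : ℝ) ≤ (P z : ℝ) + N * dist z y := by
        intro z
        refine (TopologicalSpace.denseRange_denseSeq (Fin n → M)).induction_on
          (p := fun z => ((⨅ j, F N j y : unitInterval) : ℝ) ≤ (P z : ℝ) + N * dist z y) z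
          (isClosed_le continuous_const hc) fun j => ?_
        have h₁ : ((⨅ j, F N j y : unitInterval) : ℝ) ≤ F N j y :=
          Subtype.coe_le_coe.2 (iInf_le _ j)
        refine h₁.trans ((hcoe N j y).trans_le ((min_le_right _ _).trans ?_))
        have h₂ := 𝓜.logicDist_le_dist (D j) y
        gcongr
      simpa using hle y
  rw [hPF]
  exact Definable.iSup fun N => Definable.iInf fun j => hF N j

end MetricStructure

theorem theorem3 (S : MetricSignature.{u, v, w}) [Countable S.Func] [Countable S.Pred]
    [Countable S.Const] (M : Type x) [MetricSpace M] [CompleteSpace M]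
    [TopologicalSpace.SeparableSpace M] (𝓜 : MetricStructure S M)
    (n : ℕ) (P : (Fin n → M) → unitInterval) (hP : Continuous P) :
    (∃ φ : S.Formula n, ∀ a : Fin n → M, 𝓜.value φ a = P a) ↔
      ∀ Φ : M ≃ᵢ M, 𝓜.IsAutomorphism Φ → ∀ a : Fin n → M, P (fun i => Φ (a i)) = P a := by
  constructor
  · rintro ⟨φ, hφ⟩ Φ hΦ a
    rw [← hφ, ← hφ, hΦ.value_map]
  · exact MetricStructure.definable_of_invariant hP
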